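/- Fix a finite alphabet $A$. A language $L\subseteq A^*$ is \emph{reversible} if it is regular and $L^r=L$, where $L^r=\{w^r\mid w\in L\}$ is the set of reverses of its words. A word $w=a_1\cdots a_n$ is regarded as a structure with universe its set of positions $\{1,\dots,n\}$ (empty for the empty word), with a unary predicate $P_a$ for each $a\in A$, true exactly at the positions labelled $a$, and with the ternary predicate $\mathrm{bet}(x,y,z)$, true iff $x<y<z$ or $z<y<x$. $\mathrm{FO}(\mathrm{bet})$ is first-order logic with equality over these predicates, and $L$ is \emph{$\mathrm{FO}(\mathrm{bet})$-definable} if $L=\{w\in A^*\mid w\models\varphi\}$ for some $\mathrm{FO}(\mathrm{bet})$-sentence $\varphi$. The syntactic monoid of $L$ is $M(L)=A^*/{\sim_L}$, where $x\sim_L y$ iff for all $u,v\in A^*$: $uxv\in L\Leftrightarrow uyv\in L$. A monoid $M$ is \emph{aperiodic} if there is $n\in\mathbb N$ with $a^n=a^{n+1}$ for all $a\in M$. \textbf{Proposition.} (1) A reversible language $L\subseteq A^*$ is $\mathrm{FO}(\mathrm{bet})$-definable if and only if $M(L)$ is aperiodic. (2) $\mathrm{FO}(\mathrm{bet})$-definability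 is decidable for regular languages: there is an algorithm which, given $k\in\mathbb N$ and a deterministic finite automaton over the alphabet $\{0,\dots,k-1\}$, decides whether the language accepted by the automaton is $\mathrm{FO}(\mathrm{bet})$-definable. -/

import Mathlib

/-- A reversible language: a regular language `L` with `Lʳ = L`. -/
def IsReversible {A : Type*} (L : Language A) : Prop :=
  L.IsRegular ∧ L.reverse = L

/-- Relation symbols of `FO(bet)` over the alphabet `A`: a unary symbol `P_a` for every letter `a`
and the ternary symbol `bet`. Equality belongs to first-order logic itself. -/
inductive BetRel (A : Type*) : ℕ → Type _
  | letter (a : A) : BetRel A 1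
  | bet : BetRel A 3

/-- The relational first-order vocabulary of `FO(bet)`. -/
abbrev betVocabulary (A : Type*) : FirstOrder.Language :=
  ⟨fun _ => Empty, BetRel A⟩

/-- The structure of a word `w`: its elements are the positions of `w`, `P_a` holds at the
positions labelled `a`, and `bet(x, y, z)` holds iff `x < y < z` or `z < y < x`. -/
abbrev wordStructure {A : Type*} (w : List A) :
    (betVocabulary A).Structure (Fin w.length) where
  funMap := fun f _ => Empty.elim f
  RelMap := fun {_} r =>
    match r with
    | BetRel.letter a => fun x => w.get (x 0) = a
    | BetRel.bet => fun x => (x 0 < x 1 ∧ x 1 < x 2) ∨ (x 2 < x 1 ∧ x 1 < x 0)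

/-- The word `w` satisfies the `FO(bet)` sentence `φ` (the empty word is the empty structure). -/
def WordSatisfies {A : Type*} (w : List A) (φ : (betVocabulary A).Sentence) : Prop :=
  @FirstOrder.Language.Sentence.Realize (betVocabulary A) (Fin w.length) (wordStructure w) φ

/-- `L` is the set of all finite words that satisfy some sentence of `FO(bet)`. -/
def FOBetDefinable {A : Type*} (L : Language A) : Prop :=
  ∃ φ : (betVocabulary A).Sentence, ∀ w : List A, w ∈ L ↔ WordSatisfies w φ

/-- The syntactic congruence of `L` on the free monoid `A*`:
`x ~ y` iff for all `u, v`, `uxv ∈ L ↔ uyv ∈ L`. -/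
def syntacticCon {A : Type*} (L : Language A) : Con (FreeMonoid A) where
  r x y := ∀ u v : FreeMonoid A,
    (u * x * v).toList ∈ L ↔ (u * y * v).toList ∈ L
  iseqv := ⟨fun _ _ _ => Iff.rfl, fun h u v => (h u v).symm,
    fun h h' u v => (h u v).trans (h' u v)⟩
  mul' := by
    intro a b c d hab hcd u v
    have h1 := hab u (c * v)
    have h2 := hcd (u * b) v
    simp only [mul_assoc] at h1 h2 ⊢
    exact h1.trans h2

/-- The syntactic monoid `M(L) = A* / ~`. -/
abbrev SyntacticMonoid {A : Type*} (L : Language A) : Type _ :=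
  (syntacticCon L).Quotient

/-- A monoid is aperiodic if some `n` satisfies `aⁿ = aⁿ⁺¹` for every element `a`. -/
def IsAperiodic (M : Type*) [Monoid M] : Prop :=
  ∃ n : ℕ, ∀ a : M, a ^ n = a ^ (n + 1)

/-- A finite description `(n, s, t, F)` of a deterministic automaton: the states are `0, …, n`,
the initial state is `s`, `t` is the transition table listed row by row (one row for each state,
one entry for each letter) and `F` lists the accepting states. -/
abbrev DFACode : Type := ℕ × ℕ × List ℕ × List ℕ

/-- The automaton over the alphabet `{0, …, k - 1}` described by a code. States are read
modulo the number of states and missing table entries as `0`, so that every code is meaningful. -/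
def DFACode.toDFA (k : ℕ) (c : DFACode) : DFA (Fin k) (Fin (c.1 + 1)) where
  step q a := Fin.ofNat (c.1 + 1) (c.2.2.1.getD (q.val * k + a.val) 0)
  start := Fin.ofNat (c.1 + 1) c.2.1
  accept := {q | q.val ∈ c.2.2.2}

-- Reversing a word is an isomorphism of betweenness structures, so a definable language equals its
-- reverse. That it is also aperiodic is an Ehrenfeucht–Fraïssé style induction on formulas: for
-- large N, a formula whose variables lie in u and v cannot separate u xᴺ v from u xᴺ⁺¹ v
-- (`exists_pumpInvariant`).
--
-- Conversely, an aperiodic regular language is star-free (`starFree_of_isAperiodic`, by induction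
-- through local divisors), and star-free expressions translate into first-order formulas over the
-- linear order. Betweenness defines this order once an endpoint p is named (`OrderFrom`). The
-- sentence "for some endpoint p, the word read from p lies in L" cannot tell which end was taken,
-- but for a language equal to its reverse both ends give the same answer
-- (`StarFree.foBetDefinable`).
--
-- Hence a regular language is definable iff it is reversible and aperiodic. For an automaton with
-- state set σ the exponent in aperiodicity can be fixed to |σ|, and a word matters only through its
-- action on the states and that of its reverse, so words up to a computable length suffice
-- (`foBetDefinable_accepts_iff_bounded`). The resulting finite test is primitive recursive.

attribute [local instance] wordStructure

/-! ### Definable languages are closed under reversal and aperiodic -/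

section Definability

variable {A : Type*}

/-- Reversing the positions is an isomorphism between the structures of a word and its reverse. -/
def reverseWordEquiv (w : List A) :
    (betVocabulary A).Equiv (Fin w.length) (Fin w.reverse.length) where
  toEquiv := (finCongr w.length_reverse.symm).trans Fin.revPerm
  map_fun' := fun f => Empty.elim f
  map_rel' := fun {n} r x => by
    cases r with
    | letter a =>
      simp [FirstOrder.Language.Structure.RelMap, List.getElem_reverse]
      have : w.length - 1 - (w.length - ((x 0 : ℕ) + 1)) = x 0 := by omega
      simp [this]
    | bet =>
      change (_ < _ ∧ _ < _) ∨ (_ < _ ∧ _ < _) ↔ _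
      simp [FirstOrder.Language.Structure.RelMap]
      tauto

theorem reverseWordEquiv_val (w : List A) (i : Fin w.length) :
    (reverseWordEquiv w i : ℕ) = w.length - 1 - i := by
  change ((Fin.rev (finCongr w.length_reverse.symm i) : Fin w.reverse.length) : ℕ) = _
  simp [Fin.val_rev]
  omega

theorem wordSatisfies_reverse (w : List A) (φ : (betVocabulary A).Sentence) :
    WordSatisfies w.reverse φ ↔ WordSatisfies w φ :=
  (FirstOrder.Language.StrongHomClass.realize_sentence (reverseWordEquiv w) φ).symm

theorem FOBetDefinable.reverse_eq {L : Language A} (h : FOBetDefinable L) : L.reverse = L := by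
  obtain ⟨φ, hφ⟩ := h
  ext w
  rw [Language.mem_reverse, hφ, hφ, wordSatisfies_reverse]

/-- The `n`-fold concatenation of a word with itself. -/
def wordPow (x : List A) (n : ℕ) : List A := (List.replicate n x).flatten

theorem wordPow_add (x : List A) (m n : ℕ) : wordPow x (m + n) = wordPow x m ++ wordPow x n := by
  simp only [wordPow, List.replicate_add, List.flatten_append]

theorem wordPow_one (x : List A) : wordPow x 1 = x := by
  simp [wordPow]

theorem length_wordPow (x : List A) (n : ℕ) : (wordPow x n).length = n * x.length := by
  simp [wordPow]

theorem toList_pow (x : FreeMonoid A) (n : ℕ) : (x ^ n).toList = wordPow x.toList n := by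
  induction n with
  | zero => rfl
  | succ n ih => rw [pow_succ, FreeMonoid.toList_mul, ih, wordPow_add, wordPow_one]

/-- Positions `a` of `u xᴺ v` and `b` of `u xᴺ⁺¹ v` that are the same position of `u` or of `v`;
here `m = |u|` and `l = |x|`. -/
def SamePosition (m l N a b : ℕ) : Prop :=
  (a < m ∧ b = a) ∨ (m + N * l ≤ a ∧ b = a + l)

/-- `φ` does not distinguish `u xᴺ v` from `u xᴺ⁺¹ v` under assignments in `u` and `v`. -/
def PumpInvariant {n : ℕ} (φ : (betVocabulary A).BoundedFormula Empty n) (N : ℕ) : Prop :=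
  ∀ (u x v w w' : List A), w = u ++ wordPow x N ++ v → w' = u ++ wordPow x (N + 1) ++ v →
    ∀ (s : Fin n → Fin w.length) (s' : Fin n → Fin w'.length),
      (∀ i, SamePosition u.length x.length N (s i) (s' i)) →
        (φ.Realize default s ↔ φ.Realize default s')

/-- The surplus copies of x are counted as part of v. -/
theorem PumpInvariant.mono {n : ℕ} {φ : (betVocabulary A).BoundedFormula Empty n} {N N' : ℕ}
    (h : PumpInvariant φ N) (hN : N ≤ N') : PumpInvariant φ N' := by
  obtain ⟨d, rfl⟩ := Nat.exists_eq_add_of_le hN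
  intro u x v w w' hw hw' s s' hs
  refine h u x (wordPow x d ++ v) w w' ?_ ?_ s s' fun i => ?_
  · simp [hw, wordPow_add]
  · rw [hw', show N + d + 1 = N + 1 + d by omega, wordPow_add x (N + 1)]
    simp
  · rcases hs i with h | h
    · exact Or.inl h
    · refine Or.inr ⟨le_trans ?_ h.1, h.2⟩
      gcongr

theorem getElem?_samePosition {u x v : List A} {N a b : ℕ}
    (h : SamePosition u.length x.length N a b) :
    (u ++ wordPow x N ++ v)[a]? = (u ++ wordPow x (N + 1) ++ v)[b]? := by
  rcases h with ⟨h, rfl⟩ | ⟨h, rfl⟩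
  · simp [List.getElem?_append_left h]
  · rw [List.getElem?_append_right (by simpa [length_wordPow] using h),
      List.getElem?_append_right (by simp [length_wordPow]; nlinarith)]
    congr 1
    simp only [List.length_append, length_wordPow, add_mul, one_mul]
    omega

/-- A newly quantified position leaves N copies of x untouched on one side: N + 1 copies are
absorbed either into u (`left`) or into v (`right`), and the hypothesis applies to the regrouped
words. -/
theorem PumpInvariant.all {n : ℕ} {φ : (betVocabulary A).BoundedFormula Empty (n + 1)} {N : ℕ}
    (h : PumpInvariant φ N) : PumpInvariant φ.all (2 * N + 1) := by
  intro u x v w w' hw hw' s s' hs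
  have left : ∀ (p : Fin w.length) (p' : Fin w'.length),
      (p : ℕ) < u.length + (N + 1) * x.length → (p' : ℕ) = p →
      (φ.Realize default (Fin.snoc s p : Fin (n + 1) → Fin w.length) ↔
        φ.Realize default (Fin.snoc s' p' : Fin (n + 1) → Fin w'.length)) := by
    intro p p' hp hp'
    refine h (u ++ wordPow x (N + 1)) x v w w' ?_ ?_ _ _ fun i => ?_
    · rw [hw, show 2 * N + 1 = (N + 1) + N by omega, wordPow_add]
      simp
    · rw [hw', show 2 * N + 1 + 1 = (N + 1) + (N + 1) by omega, wordPow_add]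
      simp
    · simp only [List.length_append, length_wordPow]
      refine Fin.lastCases ?_ (fun i => ?_) i
      · exact Or.inl (by simpa using ⟨hp, hp'⟩)
      · simp only [Fin.snoc_castSucc]
        rcases hs i with h | h
        · exact Or.inl ⟨by nlinarith [h.1], h.2⟩
        · exact Or.inr ⟨by nlinarith [h.1], h.2⟩
  have right : ∀ (p : Fin w.length) (p' : Fin w'.length),
      u.length + N * x.length ≤ (p : ℕ) → (p' : ℕ) = p + x.length →
      (φ.Realize default (Fin.snoc s p : Fin (n + 1) → Fin w.length) ↔
        φ.Realize default (Fin.snoc s' p' : Fin (n + 1) → Fin w'.length)) := by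
    intro p p' hp hp'
    refine h u x (wordPow x (N + 1) ++ v) w w' ?_ ?_ _ _ fun i => ?_
    · rw [hw, show 2 * N + 1 = N + (N + 1) by omega, wordPow_add]
      simp
    · rw [hw', show 2 * N + 1 + 1 = (N + 1) + (N + 1) by omega, wordPow_add]
      simp
    · refine Fin.lastCases ?_ (fun i => ?_) i
      · exact Or.inr (by simpa using ⟨hp, hp'⟩)
      · simp only [Fin.snoc_castSucc]
        rcases hs i with h | h
        · exact Or.inl h
        · exact Or.inr ⟨by nlinarith [h.1], h.2⟩
  have hlen : w'.length = w.length + x.length := by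
    simp only [hw, hw', List.length_append, length_wordPow]
    ring
  simp only [FirstOrder.Language.BoundedFormula.realize_all]
  constructor
  · intro H p'
    by_cases hp : (p' : ℕ) < u.length + (N + 1) * x.length
    · have : (p' : ℕ) < w.length := by
        simp only [hw, List.length_append, length_wordPow]
        nlinarith
      exact (left ⟨p', this⟩ p' hp rfl).1 (H _)
    -- The cut is after N + 1 copies so that a position beyond it, moved back by |x|, is still
    -- beyond N copies. This overlap is why 2N + 1 copies are used.
    · have h1 : u.length + N * x.length + x.length ≤ (p' : ℕ) := by nlinarith
      have : (p' : ℕ) - x.length < w.length := by omega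
      exact (right ⟨p' - x.length, this⟩ p' (by simp only; omega) (by simp only; omega)).1 (H _)
  · intro H p
    by_cases hp : (p : ℕ) < u.length + (N + 1) * x.length
    · exact (left p ⟨p, by omega⟩ hp rfl).2 (H _)
    · exact (right p ⟨p + x.length, by omega⟩ (by nlinarith) rfl).2 (H _)

/-- Atomic formulas need no copies (N = 0), because `SamePosition` preserves letters, equality and
order. Only quantifiers increase N. -/
theorem exists_pumpInvariant {n : ℕ} (φ : (betVocabulary A).BoundedFormula Empty n) :
    ∃ N, PumpInvariant φ N := by
  induction φ with
  | falsum => exact ⟨0, fun _ _ _ _ _ _ _ _ _ _ => Iff.rfl⟩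
  | @equal n t₁ t₂ =>
    refine ⟨0, fun u x v w w' hw hw' s s' hs => ?_⟩
    rcases t₁ with (t₁ | i) | f
    · exact t₁.elim
    · rcases t₂ with (t₂ | j) | f
      · exact t₂.elim
      · simp only [FirstOrder.Language.BoundedFormula.Realize, FirstOrder.Language.Term.realize,
          Sum.elim_inr, Fin.ext_iff]
        have := hs i
        have := hs j
        unfold SamePosition at *
        omega
      · exact f.elim
    · exact f.elim
  | @rel n l R ts =>
    refine ⟨0, fun u x v w w' hw hw' s s' hs => ?_⟩
    have hvar : ∀ i, ∃ j, ts i = .var (Sum.inr j) := by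
      intro i
      rcases ts i with (t | j) | f
      · exact t.elim
      · exact ⟨j, rfl⟩
      · exact f.elim
    choose g hg using hvar
    simp only [FirstOrder.Language.BoundedFormula.Realize, hg, FirstOrder.Language.Term.realize,
      Sum.elim_inr]
    cases R with
    | letter a =>
      have := getElem?_samePosition (v := v) (hs (g 0))
      rw [← hw, ← hw'] at this
      simp [FirstOrder.Language.Structure.RelMap] at this ⊢
      rw [this]
    | bet =>
      have h0 := hs (g 0)
      have h1 := hs (g 1)
      have h2 := hs (g 2)
      simp only [FirstOrder.Language.Structure.RelMap, Fin.lt_def]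
      unfold SamePosition at *
      omega
  | imp _ _ ih₁ ih₂ =>
    obtain ⟨N₁, h₁⟩ := ih₁
    obtain ⟨N₂, h₂⟩ := ih₂
    refine ⟨max N₁ N₂, fun u x v w w' hw hw' s s' hs => ?_⟩
    simp only [FirstOrder.Language.BoundedFormula.realize_imp]
    rw [h₁.mono (le_max_left _ _) u x v w w' hw hw' s s' hs,
      h₂.mono (le_max_right _ _) u x v w w' hw hw' s s' hs]
  | all _ ih =>
    obtain ⟨N, h⟩ := ih
    exact ⟨2 * N + 1, h.all⟩

theorem isAperiodic_syntacticMonoid_iff {L : Language A} :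
    IsAperiodic (SyntacticMonoid L) ↔ ∃ N, ∀ u x v : List A,
      u ++ wordPow x N ++ v ∈ L ↔ u ++ wordPow x (N + 1) ++ v ∈ L := by
  refine exists_congr fun N => ?_
  have key : ∀ x : FreeMonoid A, ((x : SyntacticMonoid L) ^ N = (x : SyntacticMonoid L) ^ (N + 1)) ↔
      ∀ u v : List A,
        u ++ wordPow x.toList N ++ v ∈ L ↔ u ++ wordPow x.toList (N + 1) ++ v ∈ L := by
    intro x
    change ((x ^ N : FreeMonoid A) : SyntacticMonoid L) = (x ^ (N + 1) : FreeMonoid A) ↔ _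
    rw [Con.eq]
    change (∀ u v : FreeMonoid A, _) ↔ _
    simp only [FreeMonoid.toList_mul, toList_pow]
    rfl
  constructor
  · intro h u x v
    exact (key x).1 (h _) u v
  · intro h a
    induction a using Con.induction_on with
    | H x => exact (key x).2 fun u v => h u _ v

theorem FOBetDefinable.isAperiodic {L : Language A} (h : FOBetDefinable L) :
    IsAperiodic (SyntacticMonoid L) := by
  obtain ⟨φ, hφ⟩ := h
  obtain ⟨N, hN⟩ := exists_pumpInvariant φ
  refine isAperiodic_syntacticMonoid_iff.2 ⟨N, fun u x v => ?_⟩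
  rw [hφ, hφ]
  have := hN u x v _ _ rfl rfl default default fun i => i.elim0
  exact this

end Definability

/-! ### Star-free languages and Schützenberger's theorem -/

section StarFreeLanguages

/-- The star-free languages: those obtained from finite languages by Boolean operations and
concatenation. -/
inductive StarFree {A : Type*} : Set (List A) → Prop
  | empty : StarFree ∅
  | nil : StarFree {[]}
  | letter (a : A) : StarFree {[a]}
  | compl {K : Set (List A)} : StarFree K → StarFree Kᶜ
  | union {K₁ K₂ : Set (List A)} : StarFree K₁ → StarFree K₂ → StarFree (K₁ ∪ K₂)
  | concat {K₁ K₂ : Set (List A)} : StarFree K₁ → StarFree K₂ →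
      StarFree (Set.image2 (· ++ ·) K₁ K₂)

namespace StarFree

variable {A : Type*} {K₁ K₂ : Set (List A)}

theorem univ : StarFree (Set.univ : Set (List A)) := by
  simpa using (empty (A := A)).compl

theorem inter (h₁ : StarFree K₁) (h₂ : StarFree K₂) : StarFree (K₁ ∩ K₂) := by
  simpa [Set.compl_union] using (h₁.compl.union h₂.compl).compl

theorem iUnion {ι : Type*} [Finite ι] {K : ι → Set (List A)} (h : ∀ i, StarFree (K i)) :
    StarFree (⋃ i, K i) := by
  classical
  have := Fintype.ofFinite ι
  have key : ∀ s : Finset ι, StarFree (⋃ i ∈ s, K i) := by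
    intro s
    induction s using Finset.induction with
    | empty => simpa using empty
    | insert i s _ ih => simpa [Set.iUnion_or, Set.iUnion_union_distrib] using (h i).union ih
  simpa using key Finset.univ

/-- The complement is the union of A* c A* over the finitely many letters c outside B. -/
theorem forall_mem [Finite A] (B : Set A) : StarFree {w : List A | ∀ a ∈ w, a ∈ B} := by
  have h := (iUnion fun c : ↥Bᶜ => (univ.concat (letter c.1)).concat univ).compl
  convert h using 1
  ext w
  simp only [Set.mem_ofPred_eq, Set.mem_compl_iff, Set.mem_iUnion, Set.mem_image2, Set.mem_univ,
    true_and, Set.mem_singleton_iff, exists_eq_left]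
  constructor
  · rintro h ⟨⟨c, hc⟩, _, ⟨u, rfl⟩, v, rfl⟩
    exact hc (h c (by simp))
  · intro h a ha
    by_contra hB
    obtain ⟨u, v, rfl⟩ := List.append_of_mem ha
    exact h ⟨⟨a, hB⟩, _, ⟨u, rfl⟩, v, by simp⟩

end StarFree

/-! ### Blocks ending with a marker -/

section Blocks

variable {A : Type*}

/-- The word `v₁ c v₂ c ⋯ vₖ c`. -/
def joinBlocks (c : A) (vs : List (List A)) : List A := (vs.map (· ++ [c])).flatten

theorem joinBlocks_cons (c : A) (v : List A) (vs : List (List A)) :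
    joinBlocks c (v :: vs) = v ++ c :: joinBlocks c vs := by
  simp [joinBlocks]

theorem joinBlocks_append (c : A) (vs vs' : List (List A)) :
    joinBlocks c (vs ++ vs') = joinBlocks c vs ++ joinBlocks c vs' := by
  simp [joinBlocks]

theorem append_cons_inj_of_notMem {c : A} {v v' r r' : List A} (h : c ∉ v) (h' : c ∉ v')
    (e : v ++ c :: r = v' ++ c :: r') : v = v' ∧ r = r' := by
  induction v generalizing v' with
  | nil =>
    cases v' with
    | nil => simpa using e
    | cons b v' => simp at e h'; exact absurd e.1 h'.1
  | cons a v ih =>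
    cases v' with
    | nil => simp at e h; exact absurd e.1.symm h.1
    | cons b v' =>
      simp only [List.cons_append, List.cons.injEq, List.mem_cons, not_or] at e h h'
      obtain ⟨h1, h2⟩ := ih h.2 h'.2 e.2
      exact ⟨by rw [e.1, h1], h2⟩

/-- Unique block decomposition is what makes `blockPreimage` compatible with complements. -/
theorem joinBlocks_injective {c : A} {vs vs' : List (List A)} (h : ∀ v ∈ vs, c ∉ v)
    (h' : ∀ v ∈ vs', c ∉ v) (e : joinBlocks c vs = joinBlocks c vs') : vs = vs' := by
  induction vs generalizing vs' with
  | nil =>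
    cases vs' with
    | nil => rfl
    | cons v vs' => simp [joinBlocks] at e
  | cons v vs ih =>
    cases vs' with
    | nil => simp [joinBlocks] at e
    | cons v' vs' =>
      rw [joinBlocks_cons, joinBlocks_cons] at e
      obtain ⟨h1, h2⟩ := append_cons_inj_of_notMem (h v (by simp)) (h' v' (by simp)) e
      rw [h1, ih (fun v hv => h v (by simp [hv])) (fun v hv => h' v (by simp [hv])) h2]

theorem exists_blocks (c : A) (w : List A) :
    ∃ vs v, w = joinBlocks c vs ++ v ∧ (∀ u ∈ vs, c ∉ u) ∧ c ∉ v := by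
  induction w with
  | nil => exact ⟨[], [], by simp [joinBlocks]⟩
  | cons a w ih =>
    obtain ⟨vs, v, rfl, hvs, hv⟩ := ih
    by_cases hac : a = c
    · exact ⟨[] :: vs, v, by simp [joinBlocks_cons, hac], by simpa using hvs, hv⟩
    · cases vs with
      | nil =>
        exact ⟨[], a :: v, by simp [joinBlocks], by simp, by simpa [Ne.symm hac] using hv⟩
      | cons u us =>
        refine ⟨(a :: u) :: us, v, by simp [joinBlocks_cons], ?_, hv⟩
        simpa [Ne.symm hac] using hvs

theorem mem_joinBlocks_of_mem {c a : A} {vs : List (List A)} {v : List A} (hv : v ∈ vs)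
    (ha : a ∈ v) : a ∈ joinBlocks c vs := by
  simp only [joinBlocks, List.mem_flatten, List.mem_map]
  exact ⟨v ++ [c], ⟨v, hv, rfl⟩, by simp [ha]⟩

theorem mem_joinBlocks {c a : A} {vs : List (List A)} (ha : a ∈ joinBlocks c vs) :
    a = c ∨ ∃ v ∈ vs, a ∈ v := by
  simp only [joinBlocks, List.mem_flatten, List.mem_map] at ha
  obtain ⟨_, ⟨v, hv, rfl⟩, ha⟩ := ha
  simp only [List.mem_append, List.mem_singleton] at ha
  exact ha.symm.imp_right fun h => ⟨v, hv, h⟩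

/-- The words `v₁ c ⋯ vₖ c` with blocks over `B` whose word of values lies in `K`. -/
def blockPreimage {T : Type*} (c : A) (B : Set A) (g : List A → T) (K : Set (List T)) :
    Set (List A) :=
  {w | ∃ vs, (∀ v ∈ vs, ∀ a ∈ v, a ∈ B) ∧ w = joinBlocks c vs ∧ vs.map g ∈ K}

/-- These are the words over B ∪ {c} that are empty or end with c. -/
theorem starFree_blockPreimage_univ [Finite A] {T : Type*} {c : A} {B : Set A} (g : List A → T) :
    StarFree (blockPreimage c B g Set.univ) := by
  have h := StarFree.nil.union ((StarFree.forall_mem (insert c B)).concat (StarFree.letter c))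
  convert h using 1
  ext w
  simp only [blockPreimage, Set.mem_ofPred_eq, Set.mem_univ, and_true, Set.mem_union,
    Set.mem_singleton_iff, Set.mem_image2, exists_eq_left]
  constructor
  · rintro ⟨vs, hvs, rfl⟩
    rcases List.eq_nil_or_concat vs with rfl | ⟨us, u, rfl⟩
    · simp [joinBlocks]
    · refine Or.inr ⟨joinBlocks c us ++ u, fun a ha => ?_, by simp [joinBlocks]⟩
      rcases List.mem_append.1 ha with ha | ha
      · rcases mem_joinBlocks ha with rfl | ⟨v, hv, hav⟩
        · exact Set.mem_insert _ _
        · exact Set.mem_insert_of_mem _ (hvs v (by simp [hv]) a hav)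
      · exact Set.mem_insert_of_mem _ (hvs u (by simp) a ha)
  · rintro (rfl | ⟨w, hw, rfl⟩)
    · exact ⟨[], by simp [joinBlocks]⟩
    · obtain ⟨vs, v, rfl, hvs, hv⟩ := exists_blocks c w
      refine ⟨vs ++ [v], fun u hu a ha => ?_, by simp [joinBlocks]⟩
      rcases List.mem_append.1 hu with hu | hu
      · exact Set.mem_of_mem_insert_of_ne
          (hw a (by simp [mem_joinBlocks_of_mem hu ha])) (fun e => hvs u hu (e ▸ ha))
      · obtain rfl := List.mem_singleton.1 hu
        exact Set.mem_of_mem_insert_of_ne (hw a (by simp [ha])) (fun e => hv (e ▸ ha))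

/-- Substitution into the star-free expression for K: a letter t becomes the language of blocks of
value t followed by c, and complements are taken relative to all sequences of blocks. -/
theorem starFree_blockPreimage [Finite A] {T : Type*} {c : A} {B : Set A} (hc : c ∉ B)
    {g : List A → T} (hg : ∀ t, StarFree {w | (∀ a ∈ w, a ∈ B) ∧ g w = t}) {K : Set (List T)}
    (hK : StarFree K) : StarFree (blockPreimage c B g K) := by
  induction hK with
  | empty => simpa [blockPreimage] using StarFree.empty
  | nil =>
    convert StarFree.nil using 1
    ext w
    simp only [blockPreimage, Set.mem_singleton_iff, List.map_eq_nil_iff, Set.mem_ofPred_eq]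
    exact ⟨by rintro ⟨_, _, rfl, rfl⟩; rfl, by rintro rfl; exact ⟨[], by simp [joinBlocks]⟩⟩
  | letter t =>
    convert (hg t).concat (StarFree.letter c) using 1
    ext w
    simp only [blockPreimage, Set.mem_singleton_iff, Set.mem_ofPred_eq, Set.mem_image2,
      exists_eq_left, List.map_eq_singleton_iff]
    constructor
    · rintro ⟨_, hvs, rfl, v, rfl, rfl⟩
      exact ⟨v, ⟨hvs v (by simp), rfl⟩, by simp [joinBlocks]⟩
    · rintro ⟨v, ⟨hv, rfl⟩, rfl⟩
      exact ⟨[v], by simpa using hv, by simp [joinBlocks], v, rfl, rfl⟩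
  | @compl K _ ih =>
    convert (starFree_blockPreimage_univ (c := c) (B := B) g).inter ih.compl using 1
    ext w
    constructor
    · rintro ⟨vs, hvs, rfl, h⟩
      refine ⟨⟨vs, hvs, rfl, trivial⟩, ?_⟩
      rintro ⟨vs', hvs', e, h'⟩
      rw [joinBlocks_injective (fun v hv hcv => hc (hvs v hv c hcv))
        (fun v hv hcv => hc (hvs' v hv c hcv)) e] at h
      exact h h'
    · rintro ⟨⟨vs, hvs, rfl, -⟩, h⟩
      exact ⟨vs, hvs, rfl, fun h' => h ⟨vs, hvs, rfl, h'⟩⟩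
  | union _ _ ih₁ ih₂ =>
    convert ih₁.union ih₂ using 1
    ext w
    simp only [blockPreimage, Set.mem_union, Set.mem_ofPred_eq, and_or_left, exists_or]
  | concat _ _ ih₁ ih₂ =>
    convert ih₁.concat ih₂ using 1
    ext w
    constructor
    · rintro ⟨vs, hvs, rfl, k₁, hk₁, k₂, hk₂, e⟩
      obtain ⟨vs₁, vs₂, rfl, rfl, rfl⟩ := List.map_eq_append_iff.1 e.symm
      exact ⟨_, ⟨vs₁, fun v hv => hvs v (by simp [hv]), rfl, hk₁⟩, _,
        ⟨vs₂, fun v hv => hvs v (by simp [hv]), rfl, hk₂⟩, (joinBlocks_append _ _ _).symm⟩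
    · rintro ⟨_, ⟨vs₁, h₁, rfl, hk₁⟩, _, ⟨vs₂, h₂, rfl, hk₂⟩, rfl⟩
      refine ⟨vs₁ ++ vs₂, fun v hv => ?_, (joinBlocks_append _ _ _).symm, _, hk₁, _, hk₂, by simp⟩
      exact (List.mem_append.1 hv).elim (h₁ v) (h₂ v)

end Blocks

/-! ### Local divisors -/

/-- The local divisor `cM ∩ Mc` of a monoid `M` at `c`, with the product `mc ∘ cn = mcn`. -/
def LocalDivisor {M : Type*} [Monoid M] (c : M) : Type _ :=
  {x : M // (∃ m, x = m * c) ∧ ∃ n, x = c * n}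

namespace LocalDivisor

variable {M : Type*} [Monoid M] {c : M}

noncomputable instance : Mul (LocalDivisor c) where
  mul x y := ⟨x.2.1.choose * y.1, by
    obtain ⟨m', hm'⟩ := y.2.1
    obtain ⟨n', hn'⟩ := y.2.2
    obtain ⟨n, hn⟩ := x.2.2
    refine ⟨⟨x.2.1.choose * m', by rw [mul_assoc, ← hm']⟩, ⟨n * n', ?_⟩⟩
    rw [hn', ← mul_assoc, ← x.2.1.choose_spec, hn, mul_assoc]⟩

/-- With y = cn the product is (mc)n, which depends on x but not on the choice of m. -/
theorem mul_val {x : LocalDivisor c} {m : M} (hx : x.1 = m * c) (y : LocalDivisor c) :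
    (x * y).1 = m * y.1 := by
  obtain ⟨n, hn⟩ := y.2.2
  change x.2.1.choose * y.1 = _
  rw [hn, ← mul_assoc, ← mul_assoc, ← x.2.1.choose_spec, hx]

instance : One (LocalDivisor c) := ⟨⟨c, ⟨1, by simp⟩, ⟨1, by simp⟩⟩⟩

theorem one_val : (1 : LocalDivisor c).1 = c := rfl

noncomputable instance : Monoid (LocalDivisor c) where
  mul_assoc x y z := by
    obtain ⟨m, hm⟩ := x.2.1
    obtain ⟨m', hm'⟩ := y.2.1
    have h : (x * y).1 = m * m' * c := by rw [mul_val hm, hm', mul_assoc]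
    apply Subtype.ext
    rw [mul_val h, mul_val hm, mul_val hm', mul_assoc]
  one_mul x := Subtype.ext <| by
    rw [mul_val (m := 1) (by simp [one_val]), one_mul]
  mul_one x := Subtype.ext <| by
    obtain ⟨m, hm⟩ := x.2.1
    rw [mul_val hm, one_val, hm]

theorem pow_val {x : LocalDivisor c} {m : M} (hx : x.1 = m * c) (k : ℕ) :
    (x ^ k).1 = m ^ k * c := by
  induction k with
  | zero => simp [one_val]
  | succ k ih => rw [pow_succ', mul_val hx, ih, pow_succ', mul_assoc]

theorem isAperiodic (h : IsAperiodic M) : IsAperiodic (LocalDivisor c) := by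
  obtain ⟨n, hn⟩ := h
  refine ⟨n, fun x => Subtype.ext ?_⟩
  obtain ⟨m, hm⟩ := x.2.1
  rw [pow_val hm, pow_val hm, hn]

instance [Finite M] : Finite (LocalDivisor c) := inferInstanceAs (Finite (Subtype _))

/-- The element `c t c` of the local divisor at `c`. -/
def sandwich (c t : M) : LocalDivisor c := ⟨c * t * c, ⟨c * t, rfl⟩, ⟨t * c, mul_assoc _ _ _⟩⟩

theorem sandwich_mul_val (t : M) (y : LocalDivisor c) : (sandwich c t * y).1 = c * t * y.1 :=
  mul_val rfl y

end LocalDivisor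

/-- Since cᵏmᵏ = 1 for every k, c = cⁿ⁺¹mⁿ = cⁿmⁿ = 1. -/
theorem IsAperiodic.eq_one_of_mul_eq_one {M : Type*} [Monoid M] (h : IsAperiodic M) {c m : M}
    (hcm : c * m = 1) : c = 1 := by
  obtain ⟨n, hn⟩ := h
  have key : ∀ k, c ^ k * m ^ k = 1 := by
    intro k
    induction k with
    | zero => simp
    | succ k ih => rw [pow_succ, pow_succ', mul_assoc, ← mul_assoc c, hcm, one_mul, ih]
  calc c = c * (c ^ n * m ^ n) := by rw [key, mul_one]
    _ = c ^ (n + 1) * m ^ n := by rw [← mul_assoc, pow_succ']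
    _ = 1 := by rw [← hn, key]

/-- The unit of M is missing from cM ∩ Mc: 1 = cn would force c = 1. This drives the induction on
|M|. -/
theorem LocalDivisor.card_lt {M : Type*} [Monoid M] [Finite M] (h : IsAperiodic M) {c : M}
    (hc : c ≠ 1) : Nat.card (LocalDivisor c) < Nat.card M :=
  Finite.card_subtype_lt (x := 1) fun h1 => hc <| by
    obtain ⟨n, hn⟩ := h1.2
    exact h.eq_one_of_mul_eq_one hn.symm

/-- Adjacent factors c merge in the local divisor, so the value of a run of blocks, preceded by one
c, can be computed there. -/
theorem LocalDivisor.prod_sandwich_val {A M : Type*} [Monoid M] (f : A → M) (c : A)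
    (vs : List (List A)) :
    ((vs.map fun v => (v.map f).prod).map (LocalDivisor.sandwich (f c))).prod.1 =
      f c * ((joinBlocks c vs).map f).prod := by
  induction vs with
  | nil => simp [LocalDivisor.one_val, joinBlocks]
  | cons v vs ih =>
    simp only [List.map_cons, List.prod_cons, LocalDivisor.sandwich_mul_val, joinBlocks_cons,
      List.map_append, List.prod_append]
    rw [ih]
    simp only [mul_assoc]

/-- **Schützenberger's theorem**: languages recognized by finite aperiodic monoids are
star-free. -/
theorem starFree_of_isAperiodic.{u} (n : ℕ) : ∀ (M : Type u) [Monoid M] [Finite M], Nat.card M = n →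
    IsAperiodic M → ∀ (A : Type u) [Finite A] (f : A → M) (B : Set A) (p : M),
      StarFree {w : List A | (∀ a ∈ w, a ∈ B) ∧ (w.map f).prod = p} := by
  -- Outer induction on |M|, inner induction on the number of allowed letters. If all of these have
  -- value 1, every word over B has value 1.
  induction n using Nat.strong_induction_on with
  | _ n ihM =>
  intro M _ _ hcard hM A _ f B
  induction hB : B.ncard using Nat.strong_induction_on generalizing B with
  | _ k ihB =>
  intro p
  by_cases h1 : ∀ a ∈ B, f a = 1
  · have hprod : ∀ w : List A, (∀ a ∈ w, a ∈ B) → (w.map f).prod = 1 := by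
      intro w hw
      refine List.prod_eq_one fun x hx => ?_
      obtain ⟨a, ha, rfl⟩ := List.mem_map.1 hx
      exact h1 a (hw a ha)
    by_cases hp : p = 1
    · convert StarFree.forall_mem B using 1
      ext w
      exact ⟨fun h => h.1, fun h => ⟨h, hp ▸ hprod w h⟩⟩
    · convert StarFree.empty using 1
      ext w
      simp only [Set.mem_ofPred_eq, Set.mem_empty_iff_false, iff_false, not_and]
      exact fun h e => hp (e ▸ hprod w h)
  · push Not at h1
    obtain ⟨c, hcB, hc⟩ := h1
    have hN : ∀ q, StarFree {w : List A | (∀ a ∈ w, a ∈ B \ {c}) ∧ (w.map f).prod = q} :=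
      ihB _ (hB ▸ Set.ncard_sdiff_singleton_lt_of_mem hcB) _ rfl
    -- A sequence of blocks is read as a word over the alphabet M of block values and evaluated in
    -- the smaller local divisor; hence the statement ranges over all alphabets.
    have hW : ∀ q : LocalDivisor (f c), StarFree (blockPreimage c (B \ {c})
        (fun v => (v.map f).prod)
        {k | (k.map (LocalDivisor.sandwich (f c))).prod = q}) := fun q =>
      starFree_blockPreimage (by simp) hN <| by
        simpa using ihM _ (hcard ▸ LocalDivisor.card_lt hM hc) _ rfl
          (LocalDivisor.isAperiodic hM) M (LocalDivisor.sandwich (f c)) Set.univ q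
    -- A word containing c is u c (v₁ c ⋯ vₖ c) v with c-free u, vᵢ, v. The middle component of the
    -- triple is the value of c v₁ c ⋯ vₖ c.
    have hU := StarFree.iUnion
      fun t : {t : M × LocalDivisor (f c) × M // t.1 * t.2.1.1 * t.2.2 = p} =>
        (((hN t.1.1).concat (StarFree.letter c)).concat (hW t.1.2.1)).concat (hN t.1.2.2)
    convert (hN p).union hU using 1
    ext w
    simp only [Set.mem_union, Set.mem_iUnion]
    constructor
    · rintro ⟨hw, hp⟩
      obtain ⟨vs, v, rfl, hvs, hv⟩ := exists_blocks c w
      have hvB : ∀ a ∈ v, a ∈ B \ {c} := fun a ha =>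
        ⟨hw a (by simp [ha]), fun e => hv (e ▸ ha)⟩
      cases vs with
      | nil => exact Or.inl ⟨by simpa [joinBlocks] using hvB, by simpa [joinBlocks] using hp⟩
      | cons u us =>
        have hus : ∀ x ∈ u :: us, ∀ a ∈ x, a ∈ B \ {c} := fun x hx a ha =>
          ⟨hw a (by simp [mem_joinBlocks_of_mem hx ha]), fun e => hvs x hx (e ▸ ha)⟩
        refine Or.inr ⟨⟨((u.map f).prod, ((us.map fun v => (v.map f).prod).map
          (LocalDivisor.sandwich (f c))).prod, (v.map f).prod), ?_⟩, ?_⟩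
        · simp only [LocalDivisor.prod_sandwich_val]
          simp only [joinBlocks_cons, List.map_append, List.map_cons, List.prod_append,
            List.prod_cons] at hp
          simpa only [mul_assoc] using hp
        · refine ⟨u ++ [c] ++ joinBlocks c us, ⟨u ++ [c], ⟨u, ⟨hus u (by simp), rfl⟩, [c], rfl,
            rfl⟩, joinBlocks c us, ⟨us, fun x hx => hus x (by simp [hx]), rfl, rfl⟩, rfl⟩, v,
            ⟨hvB, rfl⟩, by simp [joinBlocks_cons]⟩
    · rintro (⟨hw, hp⟩ | ⟨⟨⟨q₁, q₂, q₃⟩, hq⟩, _, ⟨_, ⟨u, ⟨hu, hu'⟩, _, rfl, rfl⟩, _,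
        ⟨us, hus, rfl, hus'⟩, rfl⟩, v, ⟨hv, hv'⟩, rfl⟩)
      · exact ⟨fun a ha => (hw a ha).1, hp⟩
      · constructor
        · intro a ha
          simp only [List.mem_append, List.mem_singleton] at ha
          rcases ha with ((ha | rfl) | ha) | ha
          · exact (hu a ha).1
          · exact hcB
          · rcases mem_joinBlocks ha with rfl | ⟨x, hx, hax⟩
            · exact hcB
            · exact (hus x hx a hax).1
          · exact (hv a ha).1
        · simp only at hq hu' hv' hus'
          have hus'' := congrArg Subtype.val hus'
          rw [LocalDivisor.prod_sandwich_val] at hus''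
          rw [← hq, ← hu', ← hv', ← hus'']
          simp [mul_assoc]

end StarFreeLanguages

/-! ### From star-free languages to betweenness formulas -/

section UniformDefinability

variable {A : Type*}

/-- A property of words with an assignment of the variables `0, 1, 2, …` that is expressed by one
`FO(bet)` formula for all words. -/
def UnifDefinable (R : ∀ w : List A, (ℕ → Fin w.length) → Prop) : Prop :=
  ∃ φ : (betVocabulary A).Formula ℕ, ∀ w s, φ.Realize s ↔ R w s

namespace UnifDefinable

variable {R R₁ R₂ : ∀ w : List A, (ℕ → Fin w.length) → Prop}

theorem congr (h : UnifDefinable R₁) (e : ∀ w s, R₁ w s ↔ R₂ w s) : UnifDefinable R₂ := by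
  obtain ⟨φ, hφ⟩ := h
  exact ⟨φ, fun w s => (hφ w s).trans (e w s)⟩

theorem const (p : Prop) : UnifDefinable (A := A) fun _ _ => p := by
  by_cases hp : p
  · exact ⟨⊤, fun w s => by simp [hp, FirstOrder.Language.Formula.Realize]⟩
  · exact ⟨⊥, fun w s => by simp [hp, FirstOrder.Language.Formula.Realize]⟩

theorem not (h : UnifDefinable R) : UnifDefinable fun w s => ¬ R w s := by
  obtain ⟨φ, hφ⟩ := h
  exact ⟨φ.not, fun w s => by rw [FirstOrder.Language.Formula.realize_not, hφ]⟩

theorem and (h₁ : UnifDefinable R₁) (h₂ : UnifDefinable R₂) :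
    UnifDefinable fun w s => R₁ w s ∧ R₂ w s := by
  obtain ⟨φ₁, h₁⟩ := h₁
  obtain ⟨φ₂, h₂⟩ := h₂
  exact ⟨φ₁ ⊓ φ₂, fun w s => by rw [FirstOrder.Language.Formula.realize_inf, h₁, h₂]⟩

theorem or (h₁ : UnifDefinable R₁) (h₂ : UnifDefinable R₂) :
    UnifDefinable fun w s => R₁ w s ∨ R₂ w s := by
  obtain ⟨φ₁, h₁⟩ := h₁
  obtain ⟨φ₂, h₂⟩ := h₂
  exact ⟨φ₁ ⊔ φ₂, fun w s => by rw [FirstOrder.Language.Formula.realize_sup, h₁, h₂]⟩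

theorem comp (h : UnifDefinable R) (g : ℕ → ℕ) : UnifDefinable fun w s => R w (s ∘ g) := by
  obtain ⟨φ, hφ⟩ := h
  exact ⟨φ.relabel g, fun w s => by rw [FirstOrder.Language.Formula.realize_relabel, hφ]⟩

theorem comp₃ {R : ∀ w : List A, Fin w.length → Fin w.length → Fin w.length → Prop}
    (h : UnifDefinable fun w s => R w (s 0) (s 1) (s 2)) (i j k : ℕ) :
    UnifDefinable fun w s => R w (s i) (s j) (s k) :=
  h.comp fun | 0 => i | 1 => j | _ => k

theorem ex (h : UnifDefinable R) (i : ℕ) :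
    UnifDefinable fun w s => ∃ x, R w (Function.update s i x) := by
  obtain ⟨φ, hφ⟩ := h
  refine ⟨(φ.relabel (fun j => if j = i then Sum.inr () else Sum.inl j)).iExs Unit,
    fun w s => ?_⟩
  rw [FirstOrder.Language.Formula.realize_iExs]
  simp only [FirstOrder.Language.Formula.realize_relabel, hφ]
  have e : ∀ t : Unit → Fin w.length,
      Sum.elim s t ∘ (fun j => if j = i then Sum.inr () else Sum.inl j) =
        Function.update s i (t ()) := by
    intro t
    ext j
    by_cases hj : j = i <;> simp [hj]
  simp only [e]
  exact ⟨fun ⟨t, ht⟩ => ⟨t (), ht⟩, fun ⟨x, hx⟩ => ⟨fun _ => x, hx⟩⟩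

theorem eq (i j : ℕ) : UnifDefinable (A := A) fun _ s => s i = s j :=
  ⟨(FirstOrder.Language.Term.var i).equal (FirstOrder.Language.Term.var j), fun w s => by
    simp [FirstOrder.Language.Formula.realize_equal]⟩

theorem letter (a : A) (i : ℕ) : UnifDefinable fun w s => w.get (s i) = a :=
  ⟨FirstOrder.Language.Relations.formula (L := betVocabulary A) (BetRel.letter a)
    (fun _ => .var i), fun w s => by
      rw [FirstOrder.Language.Formula.realize_rel]
      rfl⟩

theorem bet (i j k : ℕ) : UnifDefinable (A := A) fun _ s =>
    (s i < s j ∧ s j < s k) ∨ (s k < s j ∧ s j < s i) :=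
  ⟨FirstOrder.Language.Relations.formula (L := betVocabulary A) BetRel.bet
    ![.var i, .var j, .var k], fun w s => by
      rw [FirstOrder.Language.Formula.realize_rel]
      rfl⟩

end UnifDefinable

/-- The order of the positions that starts at the endpoint `p`. -/
def OrderFrom {n : ℕ} (p u v : Fin n) : Prop :=
  u ≠ v ∧ (u = p ∨ ((p < u ∧ u < v) ∨ (v < u ∧ u < p)))

/-- Nothing precedes p, so u < v says that u is p, or that u lies between p and v. -/
theorem orderFrom_iff_lt {n : ℕ} {p : Fin n} (hp : (p : ℕ) = 0) (u v : Fin n) :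
    OrderFrom p u v ↔ u < v := by
  simp only [OrderFrom, ne_eq, Fin.ext_iff, Fin.lt_def]
  omega

theorem UnifDefinable.orderFrom (i j k : ℕ) :
    UnifDefinable (A := A) fun _ s => OrderFrom (s i) (s j) (s k) :=
  (eq j k).not.and ((eq j i).or (bet i j k))

/-- The factor of `w` at the positions `i, …, j`. -/
def wordFactor (w : List A) (i j : ℕ) : List A := (w.take (j + 1)).drop i

theorem length_wordFactor {w : List A} {i j : ℕ} (hj : j < w.length) :
    (wordFactor w i j).length = j + 1 - i := by
  simp [wordFactor]
  omega

theorem wordFactor_append {w : List A} {i k j : ℕ} (hik : i ≤ k) (hkj : k < j)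
    (hj : j < w.length) :
    wordFactor w i k ++ wordFactor w (k + 1) j = wordFactor w i j := by
  have h : w.take (j + 1) = w.take (k + 1) ++ (w.take (j + 1)).drop (k + 1) := by
    conv_lhs => rw [← List.take_append_drop (k + 1) (w.take (j + 1))]
    rw [List.take_take, min_eq_left (by omega)]
  unfold wordFactor
  conv_rhs => rw [h]
  rw [List.drop_append_of_le_length (by simp; omega)]

theorem wordFactor_self {w : List A} {i : ℕ} (hi : i < w.length) :
    wordFactor w i i = [w[i]] := by
  rw [wordFactor, List.drop_take, List.drop_eq_getElem_cons hi, Nat.add_sub_cancel_left,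
    List.take_succ_cons, List.take_zero]

/-- Pairs of positions i ≤ j only name nonempty factors, so cuts with an empty side are listed
separately. -/
theorem wordFactor_mem_concat {K₁ K₂ : Set (List A)} {w : List A} {i j : ℕ} (hij : i ≤ j)
    (hj : j < w.length) :
    wordFactor w i j ∈ Set.image2 (· ++ ·) K₁ K₂ ↔
      ([] ∈ K₁ ∧ wordFactor w i j ∈ K₂) ∨ ([] ∈ K₂ ∧ wordFactor w i j ∈ K₁) ∨
        ∃ k, i ≤ k ∧ k < j ∧ wordFactor w i k ∈ K₁ ∧ wordFactor w (k + 1) j ∈ K₂ := by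
  constructor
  · rintro ⟨u, hu, v, hv, e⟩
    simp only at e
    rcases List.eq_nil_or_concat u with rfl | ⟨u', a, rfl⟩
    · exact Or.inl ⟨hu, by simpa [← e] using hv⟩
    · rcases v with _ | ⟨b, v⟩
      · exact Or.inr (Or.inl ⟨hv, by simpa [← e] using hu⟩)
      · have hlen := congrArg List.length e
        rw [length_wordFactor hj] at hlen
        simp only [List.length_append, List.length_concat, List.length_cons] at hlen
        have h1 : i ≤ i + u'.length := by omega
        have h2 : i + u'.length < j := by omega
        rw [← wordFactor_append h1 h2 hj] at e
        obtain ⟨e1, e2⟩ := List.append_inj e (by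
          rw [length_wordFactor (by omega), List.length_concat]
          omega)
        exact Or.inr (Or.inr ⟨i + u'.length, h1, h2, e1 ▸ hu, e2 ▸ hv⟩)
  · rintro (⟨h1, h2⟩ | ⟨h2, h1⟩ | ⟨k, h1, h2, h3, h4⟩)
    · exact ⟨_, h1, _, h2, by simp⟩
    · exact ⟨_, h1, _, h2, by simp⟩
    · exact ⟨_, h3, _, h4, wordFactor_append h1 h2 hj⟩

/-- Membership in `K` of the factor at the positions `s 1, …, s 2` is expressed in `FO(bet)`,
provided that `s 0` is the first position. -/
def FactorDefinable (K : Set (List A)) : Prop :=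
  ∃ R : ∀ w : List A, Fin w.length → Fin w.length → Fin w.length → Prop,
    (UnifDefinable fun w s => R w (s 0) (s 1) (s 2)) ∧
    ∀ w (p x y : Fin w.length), (p : ℕ) = 0 → x ≤ y → (R w p x y ↔ wordFactor w x y ∈ K)

theorem FactorDefinable.concat {K₁ K₂ : Set (List A)} (h₁ : FactorDefinable K₁)
    (h₂ : FactorDefinable K₂) : FactorDefinable (Set.image2 (· ++ ·) K₁ K₂) := by
  obtain ⟨R₁, d₁, h₁⟩ := h₁
  obtain ⟨R₂, d₂, h₂⟩ := h₂
  refine ⟨fun w p x y => ([] ∈ K₁ ∧ R₂ w p x y) ∨ ([] ∈ K₂ ∧ R₁ w p x y) ∨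
    ∃ z z', (¬ OrderFrom p z x ∧ ¬ OrderFrom p y z' ∧ OrderFrom p z z' ∧
      ¬ ∃ u, OrderFrom p z u ∧ OrderFrom p u z') ∧ R₁ w p x z ∧ R₂ w p z' y, ?_, ?_⟩
  · refine ((UnifDefinable.const _).and d₂).or (((UnifDefinable.const _).and d₁).or ?_)
    -- Variables 0, 1, 2 stand for p, x, y; 3 and 4 for the neighbours z, z' around the cut; 5 for a
    -- position between them.
    have key := (((UnifDefinable.orderFrom (A := A) 0 3 1).not.and
      ((UnifDefinable.orderFrom 0 2 4).not.and ((UnifDefinable.orderFrom 0 3 4).and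
        (((UnifDefinable.orderFrom 0 3 5).and (UnifDefinable.orderFrom 0 5 4)).ex 5).not))).and
      ((d₁.comp₃ 0 1 3).and
        (d₂.comp₃ 0 4 2))
      ).ex 4 |>.ex 3
    refine key.congr fun w s => ?_
    simp
  · intro w p x y hp hxy
    beta_reduce
    rw [wordFactor_mem_concat hxy y.2, h₁ w p x y hp hxy, h₂ w p x y hp hxy]
    refine or_congr_right (or_congr_right ?_)
    simp only [orderFrom_iff_lt hp, not_lt]
    constructor
    · rintro ⟨z, z', ⟨hxz, hzy, hzz, hsucc⟩, hz, hz'⟩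
      have e : (z' : ℕ) = z + 1 := by
        by_contra hne
        exact hsucc ⟨⟨z + 1, by omega⟩, by simp [Fin.lt_def], by simp [Fin.lt_def]; omega⟩
      rw [h₁ w p x z hp hxz] at hz
      rw [h₂ w p z' y hp hzy, e] at hz'
      exact ⟨z, hxz, by omega, hz, hz'⟩
    · rintro ⟨k, hik, hkj, hk₁, hk₂⟩
      refine ⟨⟨k, by omega⟩, ⟨k + 1, by omega⟩, ⟨hik, hkj, by simp [Fin.lt_def], ?_⟩, ?_, ?_⟩
      · rintro ⟨u, hu, hu'⟩
        simp [Fin.lt_def] at hu hu'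
        omega
      · exact (h₁ w p x _ hp hik).2 hk₁
      · exact (h₂ w p _ y hp hkj).2 hk₂

theorem StarFree.factorDefinable {K : Set (List A)} (h : StarFree K) : FactorDefinable K := by
  induction h with
  | empty => exact ⟨fun _ _ _ _ => False, .const _, fun _ _ _ _ _ _ => Iff.rfl⟩
  | nil =>
    refine ⟨fun _ _ _ _ => False, .const _, fun w p x y _ hxy => ?_⟩
    simp only [Set.mem_singleton_iff, false_iff, ← List.length_eq_zero_iff,
      length_wordFactor y.2]
    omega
  | letter a =>
    refine ⟨fun w _ x y => x = y ∧ w.get x = a,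
      (UnifDefinable.eq 1 2).and (.letter a 1), fun w p x y _ hxy => ?_⟩
    constructor
    · rintro ⟨rfl, rfl⟩
      simp [wordFactor_self x.2]
    · intro h
      have hl := congrArg List.length (Set.mem_singleton_iff.1 h)
      rw [length_wordFactor y.2] at hl
      simp only [List.length_cons, List.length_nil] at hl
      obtain rfl : x = y := by omega
      rw [wordFactor_self x.2] at h
      simpa using h
  | compl _ ih =>
    obtain ⟨R, d, h⟩ := ih
    exact ⟨fun w p x y => ¬ R w p x y, d.not,
      fun w p x y hp hxy => not_congr (h w p x y hp hxy)⟩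
  | union _ _ ih₁ ih₂ =>
    obtain ⟨R₁, d₁, h₁⟩ := ih₁
    obtain ⟨R₂, d₂, h₂⟩ := ih₂
    exact ⟨fun w p x y => R₁ w p x y ∨ R₂ w p x y, d₁.or d₂,
      fun w p x y hp hxy => or_congr (h₁ w p x y hp hxy) (h₂ w p x y hp hxy)⟩
  | concat _ _ ih₁ ih₂ => exact ih₁.concat ih₂

theorem UnifDefinable.exists_sentence {R : ∀ w : List A, (ℕ → Fin w.length) → Prop}
    (h : UnifDefinable R) :
    ∃ φ : (betVocabulary A).Sentence, ∀ w, WordSatisfies w φ ↔ ∃ x, R w fun _ => x := by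
  obtain ⟨φ, hφ⟩ := h
  refine ⟨(φ.relabel (fun _ => (Sum.inr () : Empty ⊕ Unit))).iExs Unit, fun w => ?_⟩
  unfold WordSatisfies FirstOrder.Language.Sentence.Realize
  rw [FirstOrder.Language.Formula.realize_iExs]
  simp only [FirstOrder.Language.Formula.realize_relabel, hφ]
  exact ⟨fun ⟨t, ht⟩ => ⟨t (), ht⟩, fun ⟨x, hx⟩ => ⟨fun _ => x, hx⟩⟩

/-- The position `p` is not between two others. -/
def IsEndpoint {n : ℕ} (p : Fin n) : Prop :=
  ¬ ∃ x z : Fin n, (x < p ∧ p < z) ∨ (z < p ∧ p < x)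

theorem isEndpoint_iff {n : ℕ} {p : Fin n} :
    IsEndpoint p ↔ (p : ℕ) = 0 ∨ (p : ℕ) + 1 = n := by
  constructor
  · intro h
    by_contra! hp
    exact h ⟨⟨0, by omega⟩, ⟨p + 1, by omega⟩, Or.inl ⟨by simp [Fin.lt_def]; omega,
      by simp [Fin.lt_def]⟩⟩
  · rintro h ⟨x, z, h'⟩
    omega

/-- An endpoint is guessed and the word is read from it; by `hrev` either endpoint gives the right
answer. The empty word has no endpoint and is added by hand. -/
theorem StarFree.foBetDefinable {L : Language A} (h : StarFree (L : Set (List A)))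
    (hrev : L.reverse = L) : FOBetDefinable L := by
  obtain ⟨R, d, hR⟩ := h.factorDefinable
  -- Here y is the far end, so the factor from `s 0` to y is the whole word when `s 0` is the first
  -- position.
  have key : UnifDefinable fun (w : List A) s =>
      ∃ y, (¬ ∃ z, OrderFrom (s 0) y z) ∧ R w (s 0) (s 0) y := by
    refine (((UnifDefinable.orderFrom (A := A) 0 2 3).ex 3).not.and
      (d.comp₃ 0 0 2)).ex 2 |>.congr fun w s => ?_
    simp
  have hend : UnifDefinable fun (w : List A) s => IsEndpoint (s 0) := by
    refine ((UnifDefinable.bet (A := A) 1 0 2).ex 2 |>.ex 1).not.congr fun w s => ?_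
    simp [IsEndpoint]
  obtain ⟨ψ, hψ⟩ := key
  obtain ⟨φ, hφ⟩ := (hend.and ⟨ψ, fun _ _ => Iff.rfl⟩).exists_sentence
  obtain ⟨χ, hχ⟩ := (UnifDefinable.const (A := A) True).exists_sentence
  have hfirst : ∀ (w : List A) (s : ℕ → Fin w.length), ((s 0 : Fin w.length) : ℕ) = 0 →
      (ψ.Realize s ↔ w ∈ L) := by
    intro w s hs
    have hpos : 0 < w.length := (s 0).pos
    have hw : wordFactor w 0 (w.length - 1) = w := by
      rw [wordFactor, Nat.sub_add_cancel hpos]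
      simp
    rw [hψ]
    simp only [orderFrom_iff_lt hs]
    constructor
    · rintro ⟨y, hy, hRy⟩
      rw [hR w _ _ y hs (by rw [Fin.le_def]; omega), hs] at hRy
      have : (y : ℕ) = w.length - 1 := by
        by_contra hne
        exact hy ⟨⟨y + 1, by omega⟩, by simp [Fin.lt_def]⟩
      rwa [this, hw] at hRy
    · intro hL
      refine ⟨⟨w.length - 1, by omega⟩, ?_, ?_⟩
      · rintro ⟨z, hz⟩
        rw [Fin.lt_def] at hz
        simp only at hz
        omega
      · rw [hR w _ _ _ hs (by rw [Fin.le_def]; omega), hs]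
        simp only
        rwa [hw]
  have hlast : ∀ (w : List A) (s : ℕ → Fin w.length), ((s 0 : Fin w.length) : ℕ) + 1 = w.length →
      (ψ.Realize s ↔ w ∈ L) := by
    intro w s hs
    -- The reversal isomorphism carries the last position of w to the first position of its reverse.
    rw [← FirstOrder.Language.StrongHomClass.realize_formula (reverseWordEquiv w) ψ,
      hfirst w.reverse (reverseWordEquiv w ∘ s), ← Language.mem_reverse, hrev]
    simp only [Function.comp_apply, reverseWordEquiv_val]
    omega
  have hφ' : ∀ w : List A, WordSatisfies w φ ↔ w ≠ [] ∧ w ∈ L := by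
    intro w
    rw [hφ]
    constructor
    · rintro ⟨x, hx, hw⟩
      refine ⟨by rintro rfl; exact x.elim0, ?_⟩
      rcases isEndpoint_iff.1 hx with hx | hx
      · exact (hfirst w _ hx).1 hw
      · exact (hlast w _ hx).1 hw
    · rintro ⟨hne, hw⟩
      have hpos := List.length_pos_iff.2 hne
      exact ⟨⟨0, hpos⟩, isEndpoint_iff.2 (Or.inl rfl), (hfirst w _ rfl).2 hw⟩
  have hχ' : ∀ w : List A, WordSatisfies w χ ↔ w ≠ [] := by
    intro w
    rw [hχ, ← List.length_pos_iff]
    exact ⟨fun ⟨x, _⟩ => x.pos, fun h => ⟨⟨0, h⟩, trivial⟩⟩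
  by_cases hnil : [] ∈ L
  · refine ⟨φ ⊔ χ.not, fun w => ?_⟩
    have : WordSatisfies w (φ ⊔ χ.not) ↔ WordSatisfies w φ ∨ ¬ WordSatisfies w χ := by
      simp only [WordSatisfies, FirstOrder.Language.Sentence.Realize,
        FirstOrder.Language.Formula.realize_sup, FirstOrder.Language.Formula.realize_not]
    rw [this, hφ', hχ']
    by_cases hw : w = []
    · simp [hw, hnil]
    · simp [hw]
  · refine ⟨φ, fun w => ?_⟩
    rw [hφ']
    exact ⟨fun h => ⟨fun e => hnil (e ▸ h), h⟩, fun h => h.2⟩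

end UniformDefinability

/-! ### Regular languages and the characterization of definability -/

section RegularLanguages

variable {A : Type*}

theorem DFA.evalFrom_append {σ : Type*} (M : DFA A σ) (q : σ) (u v : List A) :
    M.evalFrom q (u ++ v) = M.evalFrom (M.evalFrom q u) v :=
  M.evalFrom_of_append q u v

/-- Words with the same action on the states of an automaton are congruent, and there are finitely
many actions. -/
theorem finite_syntacticMonoid {L : Language A} (h : L.IsRegular) :
    Finite (SyntacticMonoid L) := by
  obtain ⟨σ, _, M, rfl⟩ := h
  let T : FreeMonoid A → σ → σ := fun w q => M.evalFrom q w.toList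
  have hfin : Finite (Quotient (Setoid.ker T)) :=
    Finite.of_injective _ (Setoid.kerLift_injective T)
  have hle : ∀ x y, T x = T y → syntacticCon M.accepts x y := by
    intro x y hxy u v
    simp only [FreeMonoid.toList_mul, DFA.mem_accepts, DFA.eval, DFA.evalFrom_append]
    rw [show ∀ q, M.evalFrom q x.toList = M.evalFrom q y.toList from congrFun hxy]
  let F : Quotient (Setoid.ker T) → SyntacticMonoid M.accepts :=
    Quotient.lift (fun x => (x : SyntacticMonoid M.accepts)) fun x y hxy =>
      (Con.eq _).2 (hle x y hxy)
  refine Finite.of_surjective F fun m => ?_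
  induction m using Con.induction_on with
  | H x => exact ⟨Quotient.mk _ x, rfl⟩

theorem starFree_of_isAperiodic_syntacticMonoid [Finite A] {L : Language A} (h : L.IsRegular)
    (hap : IsAperiodic (SyntacticMonoid L)) : StarFree (L : Set (List A)) := by
  have := finite_syntacticMonoid h
  let f : A → SyntacticMonoid L := fun a => (FreeMonoid.of a : FreeMonoid A)
  have hf : ∀ w : List A, (w.map f).prod = ((FreeMonoid.ofList w : FreeMonoid A) :) := by
    intro w
    induction w with
    | nil => rfl
    | cons a w ih =>
      rw [List.map_cons, List.prod_cons, ih]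
      rfl
  have key := StarFree.iUnion fun m : {m // ∃ w ∈ L, (w.map f).prod = m} =>
    starFree_of_isAperiodic _ (SyntacticMonoid L) rfl hap A f Set.univ m.1
  refine (congrArg StarFree (Set.ext fun w => ?_)).mp key
  simp only [Set.mem_univ, implies_true, true_and, Set.mem_iUnion]
  constructor
  · rintro ⟨⟨_, w', hw', rfl⟩, e⟩
    have e' : (w.map f).prod = (w'.map f).prod := e
    rw [hf, hf, Con.eq] at e'
    have := (e' 1 1).2
    simp only [one_mul, mul_one] at this
    exact this hw'
  · exact fun hw => ⟨⟨_, w, hw, rfl⟩, rfl⟩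

theorem foBetDefinable_iff_isAperiodic [Finite A] {L : Language A} (h : IsReversible L) :
    FOBetDefinable L ↔ IsAperiodic (SyntacticMonoid L) :=
  ⟨fun hL => hL.isAperiodic, fun hap =>
    (starFree_of_isAperiodic_syntacticMonoid h.1 hap).foBetDefinable h.2⟩

/-! ### A bounded criterion for automata -/

theorem evalFrom_wordPow {σ : Type*} (M : DFA A σ) (x : List A) (n : ℕ) (q : σ) :
    M.evalFrom q (wordPow x n) = (fun q => M.evalFrom q x)^[n] q := by
  induction n generalizing q with
  | zero => rfl
  | succ n ih =>
    rw [Nat.add_comm, wordPow_add, wordPow_one, DFA.evalFrom_append, ih, Nat.add_comm,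
      Function.iterate_succ_apply]

/-- In at most `|σ|` steps the iterates of a map of `σ` enter a cycle. -/
theorem exists_iterate_card_add {σ : Type*} [Fintype σ] (t : σ → σ) (q : σ) :
    ∃ d, 0 < d ∧ ∀ k, t^[Fintype.card σ + d * k] q = t^[Fintype.card σ] q := by
  obtain ⟨i, j, hij, e⟩ := Fintype.exists_ne_map_eq_of_card_lt
    (fun i : Fin (Fintype.card σ + 1) => t^[i] q) (by simp)
  wlog hlt : i < j generalizing i j
  · exact this j i hij.symm e.symm (lt_of_le_of_ne (not_lt.1 hlt) hij.symm)
  have hd : ∀ m, (i : ℕ) ≤ m → t^[m + (j - i)] q = t^[m] q := by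
    intro m hm
    obtain ⟨r, rfl⟩ := Nat.exists_eq_add_of_le' hm
    rw [show r + (i : ℕ) + (j - i) = r + j by omega, Function.iterate_add_apply, ← e,
      ← Function.iterate_add_apply]
  refine ⟨j - i, by omega, fun k => ?_⟩
  induction k with
  | zero => rfl
  | succ k ih => rw [Nat.mul_succ, ← Nat.add_assoc, hd _ (by have := i.2; omega), ih]

/-- After |σ| copies of x the run is already on a cycle, so turning round it reaches any exponent N
for which aperiodicity is known. -/
theorem isAperiodic_syntacticMonoid_accepts_iff {σ : Type*} [Fintype σ] (M : DFA A σ) :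
    IsAperiodic (SyntacticMonoid M.accepts) ↔ ∀ u x v : List A,
      u ++ wordPow x (Fintype.card σ) ++ v ∈ M.accepts ↔
        u ++ wordPow x (Fintype.card σ + 1) ++ v ∈ M.accepts := by
  rw [isAperiodic_syntacticMonoid_iff]
  refine ⟨fun ⟨N, hN⟩ u x v => ?_, fun h => ⟨_, h⟩⟩
  obtain ⟨d, hd, h⟩ := exists_iterate_card_add (fun q => M.evalFrom q x) (M.eval u)
  -- N turns of the positive length d give at least N extra copies; the first r copies join u.
  obtain ⟨r, hr⟩ : ∃ r, Fintype.card σ + d * N = r + N :=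
    Nat.exists_eq_add_of_le' (by nlinarith)
  have h' := h N
  have key := hN (u ++ wordPow x r) x v
  have e : ∀ n, u ++ wordPow x r ++ wordPow x n ++ v = u ++ wordPow x (r + n) ++ v := fun n => by
    rw [wordPow_add, List.append_assoc u]
  rw [e, e, ← Nat.add_assoc, ← hr] at key
  simp only [DFA.mem_accepts, DFA.eval, DFA.evalFrom_append, evalFrom_wordPow,
    Function.iterate_succ_apply'] at key h' ⊢
  rwa [h'] at key

theorem foBetDefinable_accepts_iff [Finite A] {σ : Type} [Fintype σ] (M : DFA A σ) :
    FOBetDefinable M.accepts ↔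
      (∀ w : List A, w ∈ M.accepts ↔ w.reverse ∈ M.accepts) ∧
      ∀ u x v : List A, u ++ wordPow x (Fintype.card σ) ++ v ∈ M.accepts ↔
        u ++ wordPow x (Fintype.card σ + 1) ++ v ∈ M.accepts := by
  rw [← isAperiodic_syntacticMonoid_accepts_iff]
  have hreg : M.accepts.IsRegular := ⟨σ, inferInstance, M, rfl⟩
  constructor
  · intro h
    refine ⟨fun w => ?_, h.isAperiodic⟩
    rw [← Language.mem_reverse, h.reverse_eq]
  · rintro ⟨h, hap⟩
    exact (foBetDefinable_iff_isAperiodic ⟨hreg, by ext w; exact (h w).symm⟩).2 hap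

/-- In a longer word two suffixes have the same value under f; deleting the factor between their
starting points preserves the value. -/
theorem exists_length_le_card {S : Type*} [Fintype S] (f : List A → S)
    (hf : ∀ a w w', f w = f w' → f (a :: w) = f (a :: w')) (w : List A) :
    ∃ w', w'.length ≤ Fintype.card S ∧ f w' = f w := by
  induction hn : w.length using Nat.strong_induction_on generalizing w with
  | _ n ih =>
  by_cases hle : w.length ≤ Fintype.card S
  · exact ⟨w, hle, rfl⟩
  have happ : ∀ u v v' : List A, f v = f v' → f (u ++ v) = f (u ++ v') := by
    intro u v v' h
    induction u with
    | nil => exact h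
    | cons a u ihu => exact hf a _ _ ihu
  obtain ⟨i, j, hij, e⟩ := Fintype.exists_ne_map_eq_of_card_lt
    (fun i : Fin (Fintype.card S + 1) => f (w.drop i)) (by simp)
  wlog hlt : i < j generalizing i j
  · exact this j i hij.symm e.symm (lt_of_le_of_ne (not_lt.1 hlt) hij.symm)
  have hw : f (w.take i ++ w.drop j) = f w := by
    rw [← happ _ _ _ e, List.take_append_drop]
  obtain ⟨w', h1, h2⟩ := ih _ (by simp; omega) (w.take i ++ w.drop j) rfl
  exact ⟨w', h1, h2.trans hw⟩

/-- Every word acts on the states like a word of bounded length, also after reversal. -/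
theorem DFA.exists_short_word {σ : Type*} [Fintype σ] (M : DFA A σ) (w : List A) :
    ∃ w' : List A, w'.length ≤ (Fintype.card σ ^ Fintype.card σ) ^ 2 ∧
      (∀ q, M.evalFrom q w' = M.evalFrom q w) ∧
      ∀ q, M.evalFrom q w'.reverse = M.evalFrom q w.reverse := by
  classical
  -- Pairing the actions of w and its reverse puts the values in a set of size (nⁿ)², n = |σ|.
  obtain ⟨w', h, e⟩ := exists_length_le_card
    (fun w => ((fun q => M.evalFrom q w, fun q => M.evalFrom q w.reverse) : (σ → σ) × (σ → σ)))
    (by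
      intro a w w' h
      simp only [Prod.mk.injEq, funext_iff] at h ⊢
      simp only [DFA.evalFrom_cons, List.reverse_cons, DFA.evalFrom_append]
      exact ⟨fun q => h.1 _, fun q => by rw [h.2]⟩) w
  simp only [Prod.mk.injEq, funext_iff] at e
  refine ⟨w', ?_, e⟩
  simpa [sq] using h

theorem foBetDefinable_accepts_iff_bounded [Finite A] {σ : Type} [Fintype σ] (M : DFA A σ) {C : ℕ}
    (hC : (Fintype.card σ ^ Fintype.card σ) ^ 2 ≤ C) :
    FOBetDefinable M.accepts ↔
      (∀ w : List A, w.length ≤ C → (w ∈ M.accepts ↔ w.reverse ∈ M.accepts)) ∧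
      ∀ u : List A, u.length ≤ C → ∀ x : List A, x.length ≤ C → ∀ v : List A, v.length ≤ C →
        (u ++ wordPow x (Fintype.card σ) ++ v ∈ M.accepts ↔
          u ++ wordPow x (Fintype.card σ + 1) ++ v ∈ M.accepts) := by
  rw [foBetDefinable_accepts_iff]
  refine and_congr ⟨fun h w _ => h w, fun h w => ?_⟩
    ⟨fun h u _ x _ v _ => h u x v, fun h u x v => ?_⟩
  · obtain ⟨w', hw, e, e'⟩ := M.exists_short_word w
    have := h w' (hw.trans hC)
    simp only [DFA.mem_accepts, DFA.eval] at this ⊢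
    rwa [e, e'] at this
  · obtain ⟨u', hu, eu, -⟩ := M.exists_short_word u
    obtain ⟨x', hx, ex, -⟩ := M.exists_short_word x
    obtain ⟨v', hv, ev, -⟩ := M.exists_short_word v
    have := h u' (hu.trans hC) x' (hx.trans hC) v' (hv.trans hC)
    simpa only [DFA.mem_accepts, DFA.eval, DFA.evalFrom_append, evalFrom_wordPow, eu, ex, ev]
      using this

end RegularLanguages

/-! ### The bounded test is primitive recursive -/

section Decidability

/-- The words of length at most `l` over `{0, …, k - 1}`. -/
def shortWords (k l : ℕ) : List (List ℕ) :=
  Nat.rec [[]] (fun _ W => [] :: W.flatMap fun w => (List.range k).map fun a => a :: w) l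

theorem mem_shortWords {k l : ℕ} {w : List ℕ} :
    w ∈ shortWords k l ↔ w.length ≤ l ∧ ∀ a ∈ w, a < k := by
  induction l generalizing w with
  | zero =>
    cases w <;> simp [shortWords]
  | succ l ih =>
    change w ∈ [] :: (shortWords k l).flatMap (fun w => (List.range k).map fun a => a :: w) ↔ _
    cases w with
    | nil => simp
    | cons a w =>
      simp only [List.mem_cons, reduceCtorEq, List.mem_flatMap, ih, List.mem_map, List.mem_range,
        false_or, List.length_cons, List.cons.injEq, forall_eq_or_imp, Nat.add_le_add_iff_right]
      constructor
      · rintro ⟨_, ⟨h1, h2⟩, _, h3, rfl, rfl⟩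
        exact ⟨h1, h3, h2⟩
      · rintro ⟨h1, h3, h2⟩
        exact ⟨w, ⟨h1, h2⟩, a, h3, rfl, rfl⟩

theorem primrec_shortWords : Primrec₂ shortWords := by
  refine Primrec.nat_rec (f := fun _ => [[]])
    (g := fun k (p : ℕ × List (List ℕ)) =>
      [] :: p.2.flatMap fun w => (List.range k).map fun a => a :: w) (Primrec.const _) ?_
  refine Primrec.list_cons.comp (Primrec.const _) (Primrec.list_flatMap
    (Primrec.snd.comp Primrec.snd) ?_)
  exact Primrec.list_map (Primrec.list_range.comp (Primrec.fst.comp Primrec.fst))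
    (Primrec.list_cons.comp Primrec.snd (Primrec.snd.comp Primrec.fst))

theorem primrec_wordPow : Primrec₂ (wordPow : List ℕ → ℕ → List ℕ) := by
  have h : Primrec₂ fun (x : List ℕ) (n : ℕ) => (List.range n).flatMap fun _ => x :=
    Primrec.list_flatMap (Primrec.list_range.comp Primrec.snd)
      (Primrec.fst.comp Primrec.fst)
  refine h.of_eq fun x n => ?_
  simp [wordPow, List.flatMap_def]

theorem primrec_nat_pow : Primrec₂ fun m n : ℕ => m ^ n :=
  Primrec₂.unpaired'.1 Nat.Primrec.pow

theorem PrimrecPred.iff {α : Type*} [Primcodable α] {p q : α → Prop} (hp : PrimrecPred p)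
    (hq : PrimrecPred q) : PrimrecPred fun a => p a ↔ q a :=
  ((hp.and hq).or (hp.not.and hq.not)).of_eq fun _ => by tauto

theorem PrimrecPred.forall_mem {α β : Type*} [Primcodable α] [Primcodable β] {f : α → List β}
    {p : α × β → Prop} (hf : Primrec f) (hp : PrimrecPred p) :
    PrimrecPred fun a => ∀ b ∈ f a, p (a, b) := by
  have h : PrimrecRel fun (b : β) (a : α) => p (a, b) :=
    hp.comp (Primrec.snd.pair Primrec.fst)
  exact h.forall_mem_list.comp hf Primrec.id

/-- Acceptance of a word of letters by the automaton over `{0, …, p.1 - 1}` with code `p.2`. -/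
def codeAccepts (p : ℕ × DFACode) (w : List ℕ) : Prop :=
  w.foldl (fun q a => p.2.2.2.1.getD (q * p.1 + a) 0 % (p.2.1 + 1)) (p.2.2.1 % (p.2.1 + 1)) ∈
    p.2.2.2.2

theorem mem_accepts_toDFA (p : ℕ × DFACode) (w : List (Fin p.1)) :
    w ∈ (DFACode.toDFA p.1 p.2).accepts ↔ codeAccepts p (w.map Fin.val) := by
  have h : ∀ q, ((DFACode.toDFA p.1 p.2).evalFrom q w : ℕ) =
      (w.map Fin.val).foldl (fun q a => p.2.2.2.1.getD (q * p.1 + a) 0 % (p.2.1 + 1)) q := by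
    induction w with
    | nil => exact fun q => rfl
    | cons a w ih => exact fun q => ih _
  exact iff_of_eq (congrArg (· ∈ p.2.2.2.2) (h _))

theorem primrecRel_codeAccepts : PrimrecRel codeAccepts := by
  have hn : Primrec fun p : ℕ × DFACode => p.2.1 + 1 :=
    Primrec.succ.comp (Primrec.fst.comp Primrec.snd)
  have hrun : Primrec fun x : (ℕ × DFACode) × List ℕ =>
      x.2.foldl (fun q a => x.1.2.2.2.1.getD (q * x.1.1 + a) 0 % (x.1.2.1 + 1))
        (x.1.2.2.1 % (x.1.2.1 + 1)) := by
    refine Primrec.list_foldl (h := fun (x : (ℕ × DFACode) × List ℕ) (y : ℕ × ℕ) =>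
      x.1.2.2.2.1.getD (y.1 * x.1.1 + y.2) 0 % (x.1.2.1 + 1)) Primrec.snd ?_ ?_
    · exact Primrec.nat_mod.comp
        (Primrec.fst.comp (Primrec.snd.comp (Primrec.snd.comp Primrec.fst))) (hn.comp Primrec.fst)
    · refine Primrec.nat_mod.comp ?_ (hn.comp (Primrec.fst.comp Primrec.fst))
      refine (Primrec.list_getD 0).comp (Primrec.fst.comp (Primrec.snd.comp (Primrec.snd.comp
        (Primrec.snd.comp (Primrec.fst.comp Primrec.fst))))) ?_
      exact Primrec.nat_add.comp (Primrec.nat_mul.comp (Primrec.fst.comp Primrec.snd)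
        (Primrec.fst.comp (Primrec.fst.comp Primrec.fst))) (Primrec.snd.comp Primrec.snd)
  have hmem : PrimrecRel fun (l : List ℕ) (q : ℕ) => ∃ a ∈ l, a = q :=
    PrimrecRel.exists_mem_list Primrec.eq
  refine (hmem.comp (Primrec.snd.comp (Primrec.snd.comp (Primrec.snd.comp
    (Primrec.snd.comp Primrec.fst)))) hrun).of_eq fun x => ?_
  simp [codeAccepts]

/-- The words on which an automaton has to be tested. -/
def testWords (p : ℕ × DFACode) : List (List ℕ) :=
  shortWords p.1 (((p.2.1 + 1) ^ (p.2.1 + 1)) ^ 2)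

theorem primrec_testWords : Primrec testWords := by
  have hn : Primrec fun p : ℕ × DFACode => p.2.1 + 1 :=
    Primrec.succ.comp (Primrec.fst.comp Primrec.snd)
  exact primrec_shortWords.comp Primrec.fst
    (primrec_nat_pow.comp (primrec_nat_pow.comp hn hn) (Primrec.const 2))

theorem forall_mem_testWords {p : ℕ × DFACode} {Q : List ℕ → Prop} :
    (∀ w ∈ testWords p, Q w) ↔ ∀ w : List (Fin p.1),
      w.length ≤ ((p.2.1 + 1) ^ (p.2.1 + 1)) ^ 2 → Q (w.map Fin.val) := by
  simp only [testWords, mem_shortWords]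
  constructor
  · intro h w hw
    exact h _ ⟨by simpa using hw, fun a ha => by
      obtain ⟨i, _, rfl⟩ := List.mem_map.1 ha
      exact i.2⟩
  · rintro h w ⟨hw, hk⟩
    have := h (w.pmap Fin.mk hk) (by simpa using hw)
    rwa [List.map_pmap, List.pmap_eq_map, List.map_id'] at this

theorem wordPow_map {A B : Type*} (f : A → B) (x : List A) (n : ℕ) :
    (wordPow x n).map f = wordPow (x.map f) n := by
  simp [wordPow, List.map_flatten]

theorem foBetDefinable_toDFA_iff (p : ℕ × DFACode) :
    FOBetDefinable (DFACode.toDFA p.1 p.2).accepts ↔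
      (∀ w ∈ testWords p, codeAccepts p w ↔ codeAccepts p w.reverse) ∧
      ∀ u ∈ testWords p, ∀ x ∈ testWords p, ∀ v ∈ testWords p,
        (codeAccepts p (u ++ wordPow x (p.2.1 + 1) ++ v) ↔
          codeAccepts p (u ++ wordPow x (p.2.1 + 2) ++ v)) := by
  rw [foBetDefinable_accepts_iff_bounded _ le_rfl]
  simp only [forall_mem_testWords, mem_accepts_toDFA, List.map_append, wordPow_map,
    List.map_reverse, Fintype.card_fin]

theorem primrecPred_foBetDefinable_toDFA : PrimrecPred fun p : ℕ × DFACode =>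
    FOBetDefinable (DFACode.toDFA p.1 p.2).accepts := by
  refine PrimrecPred.of_eq (.and ?_ ?_) fun p => (foBetDefinable_toDFA_iff p).symm
  · exact PrimrecPred.forall_mem primrec_testWords
      (p := fun y : (ℕ × DFACode) × List ℕ => codeAccepts y.1 y.2 ↔ codeAccepts y.1 y.2.reverse)
      (primrecRel_codeAccepts.iff
        (primrecRel_codeAccepts.comp Primrec.fst (Primrec.list_reverse.comp Primrec.snd)))
  -- A code stores one less than the number of states, so i = 1, 2 give the exponents |σ| and |σ| +
  -- 1.
  · have hpump : ∀ i, PrimrecPred fun y : (((ℕ × DFACode) × List ℕ) × List ℕ) × List ℕ =>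
        codeAccepts y.1.1.1 (y.1.1.2 ++ wordPow y.1.2 (y.1.1.1.2.1 + i) ++ y.2) := by
      intro i
      have hp : Primrec fun y : (((ℕ × DFACode) × List ℕ) × List ℕ) × List ℕ => y.1.1.1 :=
        Primrec.fst.comp (Primrec.fst.comp Primrec.fst)
      refine primrecRel_codeAccepts.comp hp (Primrec.list_append.comp (Primrec.list_append.comp
        (Primrec.snd.comp (Primrec.fst.comp Primrec.fst)) (primrec_wordPow.comp
          (Primrec.snd.comp Primrec.fst) ?_)) Primrec.snd)
      exact Primrec.nat_add.comp (Primrec.fst.comp (Primrec.snd.comp hp)) (Primrec.const i)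
    have h := ((hpump 1).iff (hpump 2)).forall_mem
      (primrec_testWords.comp (Primrec.fst.comp Primrec.fst))
    exact (h.forall_mem (primrec_testWords.comp Primrec.fst)).forall_mem primrec_testWords

end Decidability

theorem mainTheorem6 :
    (∀ (A : Type*) [Finite A] (L : Language A), IsReversible L →
      (FOBetDefinable L ↔ IsAperiodic (SyntacticMonoid L))) ∧
    ComputablePred (fun p : ℕ × DFACode =>
      FOBetDefinable (DFACode.toDFA p.1 p.2).accepts) := by
  exact ⟨fun _ _ _ h => foBetDefinable_iff_isAperiodic h,
    primrecPred_foBetDefinable_toDFA.computablePred⟩
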